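/- For complex vectors $a=(a_1,\dots,a_p)$, $b=(b_1,\dots,b_q)$ such that no $b_j$ is a non-positive integer, let $${}_pF_q\left(\begin{matrix}a\\ b\end{matrix}\right)=\sum_{k=0}^{\infty}\frac{(a_1)_k\cdots(a_p)_k}{(b_1)_k\cdots(b_q)_k\,k!}$$ be the generalized hypergeometric series at unit argument, where $(x)_k=x(x+1)\cdots(x+k-1)$. The series terminates if some $a_j\in\{0,-1,-2,\dots\}$. Write $\Delta(x,2)$ for the pair of parameters $x/2,\ (x+1)/2$. Let $A,B,C,D,E\in\mathbb{C}$ be such that none of the lower parameters of the two hypergeometric series below is a non-positive integer and $1+2A-C-D-E\notin\{0,-1,-2,\dots\}$ (so that the gamma functions in the numerator below are finite; $1/\Gamma$ is read as $0$ at the poles of $\Gamma$). Suppose that the ${}_4F_3$ on the right terminates; in particular this covers $-E\in\{0,1,2,\dots\}$. Then the series on the left converges, and $$ {}_{9}F_{8}\left(\begin{matrix}A,\ 1+A/2,\ B,\ \Delta(C,2),\ \Delta(D,2),\ \Delta(E,2)\\ A/2,\ 1+A-B,\ \Delta(1+2A-C,2),\ \Delta(1+2A-D,2),\ \Delta(1+2A-E,2)\end{matrix}\right)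 $$ $$ =\frac{\Gamma(1+2A-C)\,\Gamma(1+2A-D)\,\Gamma(1+2A-E)\,\Gamma(1+2A-C-D-E)}{\Gamma(1+2A)\,\Gamma(1+2A-C-D)\,\Gamma(1+2A-C-E)\,\Gamma(1+2A-D-E)}\; {}_{4}F_{3}\left(\begin{matrix}A-B+\tfrac12,\ C,\ D,\ E\\ A+\tfrac12,\ 2A-2B+1,\ C+D+E-2A\end{matrix}\right). $$ -/

import Mathlib

noncomputable section

namespace HypSeries

/-- The product of Pochhammer symbols `(a₁)_k (a₂)_k ⋯ (a_p)_k` of a parameter vector, where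
`(a)_k = a (a + 1) ⋯ (a + k - 1)`. -/
def poch (a : List ℂ) (k : ℕ) : ℂ :=
  (a.map fun x => (ascPochhammer ℂ k).eval x).prod

/-- The `k`-th term of the generalized hypergeometric series `F(a; b | x)` with upper parameter
vector `a` and lower parameter vector `b`. -/
def term (a b : List ℂ) (x : ℂ) (k : ℕ) : ℂ :=
  poch a k / (poch b k * (Nat.factorial k : ℂ)) * x ^ k

/-- No lower parameter is a non-positive integer. -/
def Admissible (b : List ℂ) : Prop :=
  ∀ x ∈ b, ∀ m : ℕ, x ≠ -(m : ℂ)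

/-- A hypergeometric series with upper parameter vector `a` terminates when some upper parameter
is a non-positive integer. -/
def Terminates (a : List ℂ) : Prop :=
  ∃ x ∈ a, ∃ n : ℕ, x = -(n : ℂ)

/-- `Δ(a, w) = (a/w, a/w + 1/w, …, a/w + (w-1)/w)`. -/
def delta (a : ℂ) (w : ℕ) : List ℂ :=
  (List.range w).map fun i => a / (w : ℂ) + (i : ℂ) / (w : ℂ)

/-- Upper parameters of the well-poised `₉F₈`. -/
def upper9 (A B C D E : ℂ) : List ℂ :=
  [A, 1 + A / 2, B] ++ delta C 2 ++ delta D 2 ++ delta E 2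

/-- Lower parameters of the well-poised `₉F₈`. -/
def lower8 (A B C D E : ℂ) : List ℂ :=
  [A / 2, 1 + A - B] ++ delta (1 + 2 * A - C) 2 ++ delta (1 + 2 * A - D) 2
    ++ delta (1 + 2 * A - E) 2

/-- Upper parameters of the `₄F₃`. -/
def upper4 (A B C D E : ℂ) : List ℂ :=
  [A - B + 1 / 2, C, D, E]

/-- Lower parameters of the `₄F₃`. -/
def lower3 (A B C D E : ℂ) : List ℂ :=
  [A + 1 / 2, 2 * A - 2 * B + 1, C + D + E - 2 * A]

/-- The gamma ratio. A pole of a gamma function in the denominator makes the ratio vanish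
(`Complex.Gamma` is `0` at its poles, and `x / 0 = 0`), in agreement with `1/Γ` being entire. -/
def gammaRatio (A C D E : ℂ) : ℂ :=
  (Complex.Gamma (1 + 2 * A - C) * Complex.Gamma (1 + 2 * A - D) * Complex.Gamma (1 + 2 * A - E)
      * Complex.Gamma (1 + 2 * A - C - D - E))
    / (Complex.Gamma (1 + 2 * A) * Complex.Gamma (1 + 2 * A - C - D)
      * Complex.Gamma (1 + 2 * A - C - E) * Complex.Gamma (1 + 2 * A - D - E))

end HypSeries

end

/-! By symmetry in `C`, `D`, `E` one may take `E = -N`, and both series become finite sums. The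
mechanism is Bailey's lemma. The factor `(A-B+1/2)_j / (j! (A+1/2)_j (2A-2B+1)_j)` of the ₄F₃ term
is itself a terminating very-well-poised ₅F₄: a sum over `k` of `wellPoisedCoeff A B k` against the
kernel `(-j)_{2k} / (j! (1+2A)_{j+2k})` (`sum_wellPoisedCoeff`). Once the sums are exchanged, the
sum over `j` is Saalschützian (`sum_bailey_kernel`); its value is the rest of the ₉F₈ term times the
reciprocal of the prefactor. The kernel requires `1 + 2A` not to be a non-positive integer, which is
not assumed. `finite_identity` recovers the excluded values of `A` by continuity. -/

namespace HypSeries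

open Filter Topology

/-! ### Rising factorials. -/

/-- The rising factorial `(x)_n = x (x + 1) ⋯ (x + n - 1)`. -/
noncomputable def rise (x : ℂ) (n : ℕ) : ℂ := (ascPochhammer ℂ n).eval x

@[simp] lemma rise_zero (x : ℂ) : rise x 0 = 1 := by simp [rise]

lemma rise_succ (x : ℂ) (n : ℕ) : rise x (n + 1) = rise x n * (x + n) := by
  simp [rise, ascPochhammer_succ_eval]

lemma rise_add (x : ℂ) (m n : ℕ) : rise x (m + n) = rise x m * rise (x + m) n := by
  induction n with
  | zero => simp
  | succ n ih => rw [← add_assoc, rise_succ, rise_succ, ih]; push_cast; ring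

lemma rise_succ_left (x : ℂ) (n : ℕ) : rise x (n + 1) = x * rise (x + 1) n := by
  rw [add_comm n 1, rise_add]; simp [rise_succ]

lemma rise_ne_zero {x : ℂ} (hx : ∀ m : ℕ, x ≠ -(m : ℂ)) (n : ℕ) : rise x n ≠ 0 := by
  induction n with
  | zero => simp
  | succ n ih =>
    rw [rise_succ]
    exact mul_ne_zero ih fun h => hx n (eq_neg_of_add_eq_zero_left h)

lemma rise_neg_eq_zero {m n : ℕ} (h : m < n) : rise (-(m : ℂ)) n = 0 := by
  obtain ⟨d, rfl⟩ := Nat.exists_eq_add_of_lt h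
  rw [add_assoc, add_comm d 1, ← add_assoc, rise_add, rise_succ]; simp

lemma rise_two_mul (x : ℂ) (k : ℕ) :
    rise x (2 * k) = 4 ^ k * (rise (x / 2) k * rise (x / 2 + 1 / 2) k) := by
  induction k with
  | zero => simp
  | succ k ih =>
    rw [show 2 * (k + 1) = 2 * k + 1 + 1 by ring, rise_succ, rise_succ, rise_succ, rise_succ, ih]
    push_cast; ring

lemma rise_neg_mul_factorial (m n : ℕ) :
    rise (-((m + n : ℕ) : ℂ)) m * (n.factorial : ℂ) = (-1) ^ m * ((m + n).factorial : ℂ) := by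
  induction m with
  | zero => simp
  | succ m ih =>
    have h : (-((m + 1 + n : ℕ) : ℂ)) + 1 = -((m + n : ℕ) : ℂ) := by push_cast; ring
    rw [rise_succ_left, h, mul_assoc, ih, add_right_comm, Nat.factorial_succ]
    push_cast; ring

/-- The factors are read in reverse order. Being free of division, the identity also holds where
some factor is zero. -/
lemma rise_reflect (s : ℂ) (m n : ℕ) :
    rise (1 - s - ((m + n : ℕ) : ℂ)) m * rise s n = (-1) ^ m * rise s (m + n) := by
  induction m with
  | zero => simp
  | succ m ih =>
    have h : 1 - s - ((m + 1 + n : ℕ) : ℂ) + 1 = 1 - s - ((m + n : ℕ) : ℂ) := by push_cast; ring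
    rw [rise_succ_left, h, mul_assoc, ih, add_right_comm, rise_succ]
    push_cast; ring

@[fun_prop]
lemma continuous_rise {f : ℂ → ℂ} (hf : Continuous f) (n : ℕ) :
    Continuous fun x => rise (f x) n :=
  (ascPochhammer ℂ n).continuous.comp hf

/-! ### The Pfaff–Saalschütz sum. -/

/-- Polynomial form of the Pfaff–Saalschütz summation theorem. -/
theorem pfaff_saalschutz (c x y : ℂ) (n : ℕ) :
    ∑ i ∈ Finset.range (n + 1), (n.choose i : ℂ) * rise x i * rise y i *
      rise (c - x - y) (n - i) * rise (c + i) (n - i) = rise (c - x) n * rise (c - y) n := by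
  induction n with
  | zero => simp
  | succ n ih =>
    set u : ℕ → ℂ := fun i => (n.choose i : ℂ) * rise x i * rise y i *
      rise (c - x - y) (n - i) * rise (c + i) (n - i) with hu
    -- A WZ certificate: the recurrence in `n` of the right-hand side holds summand by summand, up
    -- to a difference of `g`.
    set g : ℕ → ℂ := fun i => -(match i with
      | 0 => 0
      | i + 1 => (x + i) * (y + i) * u i) with hg
    have key : ∀ i ∈ Finset.range (n + 1), ((n + 1).choose i : ℂ) * rise x i * rise y i *
        rise (c - x - y) (n + 1 - i) * rise (c + i) (n + 1 - i)
        - (c - x + n) * (c - y + n) * u i = g (i + 1) - g i := by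
      intro i hi
      obtain ⟨d, rfl⟩ := Nat.exists_eq_add_of_le (Finset.mem_range_succ_iff.1 hi)
      rcases i with _ | i
      · simp only [hg, hu]
        simp only [Nat.choose_zero_right, rise_zero, Nat.sub_zero, zero_add, rise_succ]
        push_cast; ring
      · have e1 : i + 1 + d + 1 - (i + 1) = d + 1 := by omega
        have e2 : i + 1 + d - (i + 1) = d := by omega
        have e3 : i + 1 + d - i = d + 1 := by omega
        have hc : ((i + 1 + d).choose i : ℂ) * (d + 1) = (i + 1 + d).choose (i + 1) * (i + 1) := by
          have := Nat.choose_succ_right_eq (i + 1 + d) i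
          rw [e3] at this
          exact_mod_cast this.symm
        have hd : (d + 1 : ℂ) ≠ 0 := by exact_mod_cast d.succ_ne_zero
        have hc' : ((i + 1 + d).choose i : ℂ)
            = (i + 1 + d).choose (i + 1) * (i + 1) / (d + 1) := by
          rw [eq_div_iff hd, hc]
        have e4 : c + i + 1 = c + ((i + 1 : ℕ) : ℂ) := by push_cast; ring
        simp only [hg, hu, e1, e2, e3]
        rw [Nat.choose_succ_succ (i + 1 + d) i, rise_succ_left (c + i) d, e4]
        push_cast
        rw [hc']
        simp only [rise_succ]
        field_simp
        ring
    have hsum := Finset.sum_congr rfl key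
    rw [Finset.sum_range_sub, Finset.sum_sub_distrib, ← Finset.mul_sum, ih] at hsum
    -- The extra term `i = n + 1` cancels the boundary value `g (n + 1)`.
    rw [Finset.sum_range_succ, sub_eq_iff_eq_add.1 hsum]
    simp [hg, hu, rise_succ]
    ring

/-! ### The very-well-poised ₅F₄. -/

/-- The `k`-th coefficient `(A)_k (1 + A/2)_k (B)_k / ((A/2)_k (1 + A - B)_k k!)` of a
very-well-poised series. -/
noncomputable def wellPoisedCoeff (A B : ℂ) (k : ℕ) : ℂ :=
  rise A k * (A + 2 * k) * rise B k / (A * k.factorial * rise (1 + A - B) k)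

/-- The term ratio with the factors `A + 2k` divided out, as needed to shift the certificate `g` of
`sum_wellPoisedCoeff`. -/
lemma wellPoisedCoeff_succ {A B : ℂ} (k : ℕ) (hA : ∀ k : ℕ, A + 2 * k ≠ 0)
    (hAB : ∀ m : ℕ, 1 + A - B ≠ -(m : ℂ)) :
    wellPoisedCoeff A B (k + 1) * ((k + 1) * (A - B + (k + 1))) / (A + 2 * (k + 1)) =
      wellPoisedCoeff A B k * ((A + k) * (B + k)) / (A + 2 * k) := by
  have hr := rise_ne_zero hAB k
  have hk : 1 + A - B + k ≠ 0 := fun h => hAB k (eq_neg_of_add_eq_zero_left h)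
  have hf : (k.factorial : ℂ) ≠ 0 := by exact_mod_cast k.factorial_ne_zero
  have hk1 : (k + 1 : ℂ) ≠ 0 := by exact_mod_cast k.succ_ne_zero
  have hAk := hA k
  have hAk' : A + 2 * (k + 1 : ℂ) ≠ 0 := by exact_mod_cast hA (k + 1)
  have hA0 : A ≠ 0 := by simpa using hA 0
  have e : A - B + (k + 1) = 1 + A - B + k := by ring
  rw [e]
  simp only [wellPoisedCoeff, rise_succ, Nat.factorial_succ]
  push_cast
  generalize A + 2 * ((k : ℂ) + 1) = z at hAk' ⊢
  generalize A + 2 * (k : ℂ) = w at hAk ⊢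
  field_simp

/-- A terminating very-well-poised `₅F₄` sum. -/
theorem sum_wellPoisedCoeff {A B : ℂ} (hA : ∀ k : ℕ, A + 2 * k ≠ 0)
    (hAB : ∀ m : ℕ, 1 + A - B ≠ -(m : ℂ)) (hA2 : ∀ m : ℕ, 1 + 2 * A ≠ -(m : ℂ))
    (hAh : ∀ m : ℕ, A + 1 / 2 ≠ -(m : ℂ)) (hABt : ∀ m : ℕ, 2 * A - 2 * B + 1 ≠ -(m : ℂ))
    {K j : ℕ} (hj : j < 2 * K) :
    ∑ k ∈ Finset.range K, wellPoisedCoeff A B k * (rise (-(j : ℂ)) (2 * k) / j.factorial) /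
        rise (1 + 2 * A) (j + 2 * k) =
      rise (A - B + 1 / 2) j /
        (j.factorial * rise (A + 1 / 2) j * rise (2 * A - 2 * B + 1) j) := by
  induction j with
  | zero =>
    have hA0 : A ≠ 0 := by simpa using hA 0
    rw [Finset.sum_eq_single 0]
    · simp [wellPoisedCoeff, hA0]
    · intro k _ hk
      rw [rise_neg_eq_zero (by omega)]; simp
    · intro h
      exact absurd (Finset.mem_range.2 (by omega)) h
  | succ j ih =>
    specialize ih (by omega)
    have hj1 : (j + 1 : ℂ) ≠ 0 := by exact_mod_cast j.succ_ne_zero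
    have hjf : (j.factorial : ℂ) ≠ 0 := by exact_mod_cast j.factorial_ne_zero
    -- Certificate for the first-order recurrence in `j`. Its factor `k` gives `g 0 = 0`, and
    -- `(-(j+1))_{2K} = 0` gives `g K = 0` because `j + 1 < 2K`.
    set g : ℕ → ℂ := fun k => -2 * (wellPoisedCoeff A B k * (k * (A - B + k)) / (A + 2 * k)) *
      (rise (-((j + 1 : ℕ) : ℂ)) (2 * k) / (j + 1).factorial / rise (1 + 2 * A) (j + 2 * k)) *
      (2 * A + j + 2 * k) with hg
    have key : ∀ k ∈ Finset.range K,
        (j + 1) * (2 * A + 1 + 2 * j) * (2 * A - 2 * B + 1 + j) *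
          (wellPoisedCoeff A B k * (rise (-((j + 1 : ℕ) : ℂ)) (2 * k) / (j + 1).factorial) /
            rise (1 + 2 * A) (j + 1 + 2 * k)) - (2 * A - 2 * B + 1 + 2 * j) *
          (wellPoisedCoeff A B k * (rise (-(j : ℂ)) (2 * k) / j.factorial) /
            rise (1 + 2 * A) (j + 2 * k)) = g (k + 1) - g k := by
      intro k _
      have hV : rise (-(j : ℂ)) (2 * k) =
          rise (-((j + 1 : ℕ) : ℂ)) (2 * k) * (j + 1 - 2 * k) / (j + 1) := by
        have h := (rise_succ_left (-((j + 1 : ℕ) : ℂ)) (2 * k)).symm.trans (rise_succ _ _)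
        rw [show -((j + 1 : ℕ) : ℂ) + 1 = -(j : ℂ) by push_cast; ring] at h
        rw [eq_div_iff hj1]
        push_cast at h ⊢
        linear_combination -h
      have hW0 := rise_ne_zero hA2 (j + 2 * k)
      have hW1 : 1 + 2 * A + j + 2 * k ≠ 0 := fun h =>
        hA2 (j + 2 * k) (by push_cast; linear_combination h)
      have hW2 : 1 + 2 * A + j + 2 * k + 1 ≠ 0 := fun h =>
        hA2 (j + 2 * k + 1) (by push_cast; linear_combination h)
      have hAk := hA k
      have hgs : g (k + 1) = -2 * (wellPoisedCoeff A B k * ((A + k) * (B + k)) / (A + 2 * k)) *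
          (rise (-((j + 1 : ℕ) : ℂ)) (2 * k) * (-(j + 1) + 2 * k) * (-(j + 1) + 2 * k + 1) /
            (j + 1).factorial / (rise (1 + 2 * A) (j + 2 * k) * (1 + 2 * A + j + 2 * k))) := by
        rw [← wellPoisedCoeff_succ k hA hAB]
        simp only [hg]
        rw [show 2 * (k + 1) = 2 * k + 1 + 1 by ring, ← add_assoc j, ← add_assoc j, rise_succ,
          rise_succ, rise_succ (1 + 2 * A), rise_succ (1 + 2 * A)]
        push_cast
        have e1 : 1 + 2 * A + (j + 2 * k) = 1 + 2 * A + j + 2 * k := by ring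
        have e2 : 1 + 2 * A + (j + 2 * k + 1) = 1 + 2 * A + j + 2 * k + 1 := by ring
        have e3 : 2 * A + j + 2 * (k + 1) = 1 + 2 * A + j + 2 * k + 1 := by ring
        rw [e1, e2, e3]
        generalize 1 + 2 * A + (j : ℂ) + 2 * k + 1 = z at hW2 ⊢
        field_simp
        ring
      rw [hgs, hV, add_right_comm j 1, rise_succ (1 + 2 * A)]
      simp only [hg, Nat.factorial_succ]
      push_cast
      rw [← add_assoc]
      generalize rise (-((j : ℂ) + 1)) (2 * k) = V
      generalize rise (1 + 2 * A) (j + 2 * k) = W at hW0 ⊢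
      generalize wellPoisedCoeff A B k = w
      field_simp
      ring
    have hsum := Finset.sum_congr rfl key
    have hgK : g K = 0 := by
      simp only [hg]
      rw [rise_neg_eq_zero hj]; simp
    have hg0 : g 0 = 0 := by simp [hg]
    rw [Finset.sum_range_sub, Finset.sum_sub_distrib, ← Finset.mul_sum, ← Finset.mul_sum, ih, hgK,
      hg0, sub_zero, sub_eq_zero] at hsum
    have h1 : A + 1 / 2 + j ≠ 0 := fun h => hAh j (eq_neg_of_add_eq_zero_left h)
    have h2 : 2 * A - 2 * B + 1 + j ≠ 0 := fun h => hABt j (eq_neg_of_add_eq_zero_left h)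
    have h3 : (j + 1) * (2 * A + 1 + 2 * j) * (2 * A - 2 * B + 1 + j) ≠ 0 :=
      mul_ne_zero (mul_ne_zero hj1 fun h => h1 (by linear_combination h / 2)) h2
    have h4 := rise_ne_zero hAh j
    have h5 := rise_ne_zero hABt j
    rw [mul_comm, ← eq_div_iff h3] at hsum
    rw [hsum, rise_succ, rise_succ, rise_succ, Nat.factorial_succ]
    push_cast
    have e : 2 * A + 1 + 2 * (j : ℂ) = 2 * (A + 1 / 2 + j) := by ring
    rw [e]
    generalize A + 1 / 2 + (j : ℂ) = z at h1 ⊢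
    field_simp

/-! ### Bailey's lemma. -/

/-- The Pfaff–Saalschütz summation of the inner series in Bailey's lemma. -/
theorem sum_bailey_kernel {a C D : ℂ} {N m : ℕ} (hm : Even m)
    (ha : ∀ m : ℕ, 1 + a ≠ -(m : ℂ)) (haC : rise (1 + a - C) N ≠ 0) (haD : rise (1 + a - D) N ≠ 0)
    (haCD : rise (1 + a - C - D) N ≠ 0) :
    ∑ j ∈ Finset.range (N + 1), rise C j * rise D j * rise (-(N : ℂ)) j /
        rise (C + D + -(N : ℂ) - a) j * (rise (-(j : ℂ)) m / j.factorial) / rise (1 + a) (j + m) =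
      rise C m * rise D m * rise (-(N : ℂ)) m /
        (rise (1 + a - C) m * rise (1 + a - D) m * rise (1 + a - -(N : ℂ)) m) *
        (rise (1 + a - C) N * rise (1 + a - D) N / (rise (1 + a) N * rise (1 + a - C - D) N)) := by
  rcases lt_or_ge N m with hNm | hmN
  · rw [rise_neg_eq_zero hNm, Finset.sum_eq_zero]
    · simp
    · intro j hj
      rw [rise_neg_eq_zero (show j < m by have := Finset.mem_range.1 hj; omega)]; simp
  obtain ⟨n, rfl⟩ := Nat.exists_eq_add_of_le hmN
  have hfac : ∀ i : ℕ, (i.factorial : ℂ) ≠ 0 := fun i => by exact_mod_cast i.factorial_ne_zero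
  -- The factor `(-j)_m` kills every `j < m`; writing `j = m + i` leaves a Saalschütz sum with `C`,
  -- `D` shifted by `m` and `1 + a` by `2m`.
  rw [add_assoc m n 1, Finset.sum_range_add, Finset.sum_eq_zero, zero_add]
  swap
  · intro j hj
    rw [rise_neg_eq_zero (Finset.mem_range.1 hj)]; simp
  have hS := pfaff_saalschutz (1 + a + 2 * m) (C + m) (D + m) n
  have e0 : 1 + a + 2 * m - (C + m) - (D + m) = 1 + a - C - D := by ring
  have e1 : 1 + a + 2 * m - (C + m) = 1 + a - C + m := by ring
  have e2 : 1 + a + 2 * m - (D + m) = 1 + a - D + m := by ring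
  rw [e0, e1, e2] at hS
  have hterm : ∀ i ∈ Finset.range (n + 1), rise C (m + i) * rise D (m + i) *
      rise (-((m + n : ℕ) : ℂ)) (m + i) / rise (C + D + -((m + n : ℕ) : ℂ) - a) (m + i) *
      (rise (-((m + i : ℕ) : ℂ)) m / (m + i).factorial) / rise (1 + a) (m + i + m) =
      ((m + n).factorial : ℂ) / (rise (1 + a - C - D) (m + n) * n.factorial) * rise C m * rise D m /
        rise (1 + a) (m + n + m) *
      ((n.choose i : ℂ) * rise (C + m) i * rise (D + m) i *
      rise (1 + a - C - D) (n - i) * rise (1 + a + 2 * m + i) (n - i)) := by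
    intro i hi
    obtain ⟨d, rfl⟩ := Nat.exists_eq_add_of_le (Finset.mem_range_succ_iff.1 hi)
    have f1 := rise_neg_mul_factorial (m + i) d
    have f2 := rise_reflect (1 + a - C - D) (m + i) d
    have f3 := rise_neg_mul_factorial m i
    have f4 : ((i + d).choose i : ℂ) * i.factorial * d.factorial = (i + d).factorial := by
      have := Nat.choose_mul_factorial_mul_factorial (Nat.le_add_right i d)
      rw [Nat.add_sub_cancel_left] at this
      exact_mod_cast this
    have f5 : rise (1 + a) (m + (i + d) + m) =
        rise (1 + a) (m + i + m) * rise (1 + a + 2 * m + i) d := by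
      rw [show m + (i + d) + m = m + i + m + d by ring, rise_add]
      congr 2; push_cast; ring
    -- Evenness of `m` removes the sign of `(-j)_m`.
    rw [hm.neg_one_pow, one_mul] at f3
    rw [show C + D + -((m + (i + d) : ℕ) : ℂ) - a = 1 - (1 + a - C - D) - ((m + i + d : ℕ) : ℂ) by
      push_cast; ring, Nat.add_sub_cancel_left, f5, rise_add C, rise_add D, ← f4, ← f3,
      ← add_assoc m i d]
    rw [← add_assoc m i d] at haCD
    have g1 := hfac i
    have g2 := hfac d
    have g3 : (m + i : ℕ).factorial ≠ (0 : ℂ) := hfac (m + i)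
    rw [← f3] at g3
    have g4 := left_ne_zero_of_mul g3
    have g5 : rise (1 + a) (m + i + m) * rise (1 + a + 2 * m + i) d ≠ 0 := f5 ▸ rise_ne_zero ha _
    have g6 := left_ne_zero_of_mul g5
    have g7 := right_ne_zero_of_mul g5
    have hneg : ((-1 : ℂ) ^ (m + i)) ≠ 0 := pow_ne_zero _ (by norm_num)
    have g8 : rise (1 - (1 + a - C - D) - ((m + i + d : ℕ) : ℂ)) (m + i) * rise (1 + a - C - D) d
        ≠ 0 := f2 ▸ mul_ne_zero hneg haCD
    have g9 := left_ne_zero_of_mul g8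
    have hchoose : ((i + d).choose i : ℂ) ≠ 0 := by
      exact_mod_cast (Nat.choose_pos (Nat.le_add_right i d)).ne'
    -- `f1` and `f2` carry the same sign `(-1)^(m+i)`, which drops out of the quotient.
    have hq : rise (-((m + i + d : ℕ) : ℂ)) (m + i) /
        rise (1 - (1 + a - C - D) - ((m + i + d : ℕ) : ℂ)) (m + i) =
        (m + i + d).factorial / d.factorial * rise (1 + a - C - D) d /
          rise (1 + a - C - D) (m + i + d) := by
      rw [div_mul_eq_mul_div, div_div, div_eq_div_iff g9 (mul_ne_zero g2 haCD)]
      apply mul_left_cancel₀ hneg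
      linear_combination (-1) ^ (m + i) * rise (1 + a - C - D) (m + i + d) * f1 -
        (-1) ^ (m + i) * (m + i + d).factorial * f2
    rw [mul_div_assoc (_ * _) (rise (-((m + i + d : ℕ) : ℂ)) (m + i)), hq]
    generalize rise (1 + a + 2 * m + i) d = r at g7 ⊢
    field_simp
  rw [Finset.sum_congr rfl hterm, ← Finset.mul_sum, hS]
  have f1 := rise_neg_mul_factorial m n
  rw [hm.neg_one_pow, one_mul] at f1
  have f2 : rise (1 + a - -((m + n : ℕ) : ℂ)) m = rise (1 + a) (m + n + m) / rise (1 + a) (m + n) := by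
    rw [rise_add (1 + a) (m + n) m, sub_neg_eq_add, mul_div_cancel_left₀ _ (rise_ne_zero ha _)]
  rw [rise_add (1 + a - C) m n] at haC ⊢
  rw [rise_add (1 + a - D) m n] at haD ⊢
  have g1 := rise_ne_zero ha (m + n)
  have g2 := rise_ne_zero ha (m + n + m)
  have g3 := left_ne_zero_of_mul haC
  have g4 := left_ne_zero_of_mul haD
  have g5 := hfac n
  rw [f2, ← f1]
  field_simp

lemma finite_identity_of_generic {A B C D : ℂ} {N : ℕ} (hA : ∀ k : ℕ, A + 2 * k ≠ 0)
    (hAB : ∀ m : ℕ, 1 + A - B ≠ -(m : ℂ)) (hA2 : ∀ m : ℕ, 1 + 2 * A ≠ -(m : ℂ))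
    (hAh : ∀ m : ℕ, A + 1 / 2 ≠ -(m : ℂ)) (hABt : ∀ m : ℕ, 2 * A - 2 * B + 1 ≠ -(m : ℂ))
    (haC : rise (1 + 2 * A - C) N ≠ 0) (haD : rise (1 + 2 * A - D) N ≠ 0)
    (haCD : rise (1 + 2 * A - C - D) N ≠ 0) :
    ∑ k ∈ Finset.range (N + 1), wellPoisedCoeff A B k *
        (rise C (2 * k) * rise D (2 * k) * rise (-(N : ℂ)) (2 * k) /
          (rise (1 + 2 * A - C) (2 * k) * rise (1 + 2 * A - D) (2 * k) *
            rise (1 + 2 * A - -(N : ℂ)) (2 * k))) =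
      rise (1 + 2 * A) N * rise (1 + 2 * A - C - D) N /
          (rise (1 + 2 * A - C) N * rise (1 + 2 * A - D) N) *
        ∑ j ∈ Finset.range (N + 1),
          rise (A - B + 1 / 2) j * rise C j * rise D j * rise (-(N : ℂ)) j /
            (rise (A + 1 / 2) j * rise (2 * A - 2 * B + 1) j *
              rise (C + D + -(N : ℂ) - 2 * A) j * j.factorial) := by
  have h2N := rise_ne_zero hA2 N
  have hR : ∀ j ∈ Finset.range (N + 1),
      rise (A - B + 1 / 2) j * rise C j * rise D j * rise (-(N : ℂ)) j /
            (rise (A + 1 / 2) j * rise (2 * A - 2 * B + 1) j *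
              rise (C + D + -(N : ℂ) - 2 * A) j * j.factorial) =
      ∑ k ∈ Finset.range (N + 1), wellPoisedCoeff A B k *
        (rise C j * rise D j * rise (-(N : ℂ)) j / rise (C + D + -(N : ℂ) - 2 * A) j *
          (rise (-(j : ℂ)) (2 * k) / j.factorial) / rise (1 + 2 * A) (j + 2 * k)) := by
    intro j hj
    have := sum_wellPoisedCoeff hA hAB hA2 hAh hABt
      (show j < 2 * (N + 1) by have := Finset.mem_range.1 hj; omega)
    calc _ = rise C j * rise D j * rise (-(N : ℂ)) j / rise (C + D + -(N : ℂ) - 2 * A) j *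
          (rise (A - B + 1 / 2) j /
            (j.factorial * rise (A + 1 / 2) j * rise (2 * A - 2 * B + 1) j)) := by
            rw [div_mul_div_comm]; congr 1 <;> ring
      _ = _ := by
        rw [← this, Finset.mul_sum]
        exact Finset.sum_congr rfl fun k _ => by ring
  rw [Finset.sum_congr rfl hR, Finset.sum_comm, Finset.mul_sum]
  refine Finset.sum_congr rfl fun k _ => ?_
  rw [← Finset.mul_sum, sum_bailey_kernel (even_two_mul k) hA2 haC haD haCD]
  field_simp

/-! ### Removing the genericity of `1 + 2A`. -/

/-- The non-positive integers are the zeros of the continuous function `1/Γ`, so avoiding all of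
them at once is an open condition. -/
lemma eventually_ne_neg_natCast {f : ℂ → ℂ} (hf : Continuous f) {z : ℂ}
    (h : ∀ m : ℕ, f z ≠ -(m : ℂ)) : ∀ᶠ w in 𝓝 z, ∀ m : ℕ, f w ≠ -(m : ℂ) := by
  have hc : ContinuousAt (fun w => (Complex.Gamma (f w))⁻¹) z :=
    (Complex.differentiable_one_div_Gamma.continuous.comp hf).continuousAt
  filter_upwards [hc.eventually_ne (inv_ne_zero (Complex.Gamma_ne_zero h))] with w hw m hm
  exact hw (by rw [(Complex.Gamma_eq_zero_iff _).2 ⟨m, hm⟩, inv_zero])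

lemma dense_one_add_two_mul_ne : Dense {A : ℂ | ∀ m : ℕ, 1 + 2 * A ≠ -(m : ℂ)} := by
  have hd := (Set.countable_range fun m : ℕ => (-(m : ℂ) - 1) / 2).dense_compl ℝ
  refine Dense.mono ?_ hd
  intro A hA m hm
  refine hA ⟨m, ?_⟩
  simp only [← hm]
  ring

/-- The transformation formula for terminating series, with rising factorials for the gamma
functions. -/
theorem finite_identity {A B C D : ℂ} {N : ℕ} (hA : ∀ k : ℕ, A / 2 ≠ -(k : ℂ))
    (hAB : ∀ m : ℕ, 1 + A - B ≠ -(m : ℂ))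
    (hAh : ∀ m : ℕ, A + 1 / 2 ≠ -(m : ℂ)) (hABt : ∀ m : ℕ, 2 * A - 2 * B + 1 ≠ -(m : ℂ))
    (haC : ∀ m : ℕ, 1 + 2 * A - C ≠ -(m : ℂ)) (haD : ∀ m : ℕ, 1 + 2 * A - D ≠ -(m : ℂ))
    (haN : ∀ m : ℕ, 1 + 2 * A - -(N : ℂ) ≠ -(m : ℂ))
    (haCD : ∀ m : ℕ, C + D + -(N : ℂ) - 2 * A ≠ -(m : ℂ)) :
    ∑ k ∈ Finset.range (N + 1), wellPoisedCoeff A B k *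
        (rise C (2 * k) * rise D (2 * k) * rise (-(N : ℂ)) (2 * k) /
          (rise (1 + 2 * A - C) (2 * k) * rise (1 + 2 * A - D) (2 * k) *
            rise (1 + 2 * A - -(N : ℂ)) (2 * k))) =
      rise (1 + 2 * A) N * rise (1 + 2 * A - C - D) N /
          (rise (1 + 2 * A - C) N * rise (1 + 2 * A - D) N) *
        ∑ j ∈ Finset.range (N + 1),
          rise (A - B + 1 / 2) j * rise C j * rise D j * rise (-(N : ℂ)) j /
            (rise (A + 1 / 2) j * rise (2 * A - 2 * B + 1) j *
              rise (C + D + -(N : ℂ) - 2 * A) j * j.factorial) := by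
  set L : ℂ → ℂ := fun A => ∑ k ∈ Finset.range (N + 1), wellPoisedCoeff A B k *
        (rise C (2 * k) * rise D (2 * k) * rise (-(N : ℂ)) (2 * k) /
          (rise (1 + 2 * A - C) (2 * k) * rise (1 + 2 * A - D) (2 * k) *
            rise (1 + 2 * A - -(N : ℂ)) (2 * k))) with hL
  set R : ℂ → ℂ := fun A => rise (1 + 2 * A) N * rise (1 + 2 * A - C - D) N /
          (rise (1 + 2 * A - C) N * rise (1 + 2 * A - D) N) *
        ∑ j ∈ Finset.range (N + 1),
          rise (A - B + 1 / 2) j * rise C j * rise D j * rise (-(N : ℂ)) j /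
            (rise (A + 1 / 2) j * rise (2 * A - 2 * B + 1) j *
              rise (C + D + -(N : ℂ) - 2 * A) j * j.factorial) with hR
  change L A = R A
  have hfac : ∀ i : ℕ, (i.factorial : ℂ) ≠ 0 := fun i => by exact_mod_cast i.factorial_ne_zero
  have hA0 : A ≠ 0 := by simpa using hA 0
  have hLc : ContinuousAt L A := by
    refine tendsto_finsetSum _ fun k _ => ContinuousAt.mul (ContinuousAt.div ?_ ?_ ?_)
      (ContinuousAt.div ?_ ?_ ?_)
    any_goals exact Continuous.continuousAt (by fun_prop)
    · exact mul_ne_zero (mul_ne_zero hA0 (hfac k)) (rise_ne_zero hAB k)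
    · exact mul_ne_zero (mul_ne_zero (rise_ne_zero haC _) (rise_ne_zero haD _))
        (rise_ne_zero haN _)
  have hRc : ContinuousAt R A := by
    refine ContinuousAt.mul (ContinuousAt.div ?_ ?_ ?_)
      (tendsto_finsetSum _ fun k _ => ContinuousAt.div ?_ ?_ ?_)
    any_goals exact Continuous.continuousAt (by fun_prop)
    · exact mul_ne_zero (rise_ne_zero haC _) (rise_ne_zero haD _)
    · exact mul_ne_zero (mul_ne_zero (mul_ne_zero (rise_ne_zero hAh _) (rise_ne_zero hABt _))
        (rise_ne_zero haCD _)) (hfac k)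
  -- `A` is a limit of generic points, so limits along this filter are unique.
  have hne : (𝓝[{A : ℂ | ∀ m : ℕ, 1 + 2 * A ≠ -(m : ℂ)}] A).NeBot :=
    mem_closure_iff_nhdsWithin_neBot.1 (dense_one_add_two_mul_ne A)
  refine tendsto_nhds_unique_of_eventuallyEq
    (l := 𝓝[{A : ℂ | ∀ m : ℕ, 1 + 2 * A ≠ -(m : ℂ)}] A) (hLc.mono_left nhdsWithin_le_nhds)
    (hRc.mono_left nhdsWithin_le_nhds) ?_
  have ev := fun {f : ℂ → ℂ} (hf : Continuous f) (h : ∀ m : ℕ, f A ≠ -(m : ℂ)) =>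
    nhdsWithin_le_nhds (s := {A : ℂ | ∀ m : ℕ, 1 + 2 * A ≠ -(m : ℂ)})
      (eventually_ne_neg_natCast hf h)
  filter_upwards [self_mem_nhdsWithin, ev (f := fun A => A / 2) (by fun_prop) hA,
    ev (f := fun A => 1 + A - B) (by fun_prop) hAB,
    ev (f := fun A => A + 1 / 2) (by fun_prop) hAh,
    ev (f := fun A => 2 * A - 2 * B + 1) (by fun_prop) hABt,
    ev (f := fun A => 1 + 2 * A - C) (by fun_prop) haC,
    ev (f := fun A => 1 + 2 * A - D) (by fun_prop) haD,
    ev (f := fun A => C + D + -(N : ℂ) - 2 * A) (by fun_prop) haCD] with x h1 h2 h3 h4 h5 h6 h7 h8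
  refine finite_identity_of_generic (fun k hk => h2 k (by linear_combination hk / 2)) h3 h1 h4 h5
    (rise_ne_zero h6 N) (rise_ne_zero h7 N) fun h0 => ?_
  -- Reversal gives `(1+2x-C-D)_N = ±(C+D-N-2x)_N`, and the latter is nonzero by `h8`.
  have h := rise_reflect (1 + 2 * x - C - D) N 0
  rw [add_zero, h0, rise_zero, mul_one, mul_zero] at h
  refine rise_ne_zero (fun m hm => h8 m ?_) N h
  rw [← hm]; ring

/-! ### Gamma quotients. -/

/-- At a pole `x = -m` the quotient is `0` by the conventions `Γ(-m) = 0` and `z / 0 = 0`. There `m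
< n`, as `x + n` is not a pole, so `(x)_n` vanishes too. -/
lemma Gamma_add_natCast_div_Gamma {x : ℂ} {n : ℕ} (h : ∀ m : ℕ, x + n ≠ -(m : ℂ)) :
    Complex.Gamma (x + n) / Complex.Gamma x = rise x n := by
  by_cases hx : ∀ m : ℕ, x ≠ -(m : ℂ)
  · rw [div_eq_iff (Complex.Gamma_ne_zero hx)]
    clear h
    induction n with
    | zero => simp
    | succ n ih =>
      have hn : x + n ≠ 0 := fun h => hx n (eq_neg_of_add_eq_zero_left h)
      rw [Nat.cast_succ, ← add_assoc, Complex.Gamma_add_one _ hn, ih, rise_succ]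
      ring
  · push Not at hx
    obtain ⟨m, rfl⟩ := hx
    have hmn : m < n := by
      by_contra! hnm
      obtain ⟨d, rfl⟩ := Nat.exists_eq_add_of_le hnm
      exact h d (by push_cast; ring)
    rw [rise_neg_eq_zero hmn, (Complex.Gamma_eq_zero_iff _).2 ⟨m, rfl⟩, div_zero]

lemma gammaRatio_neg_natCast {A C D : ℂ} {N : ℕ} (haC : ∀ m : ℕ, 1 + 2 * A - C ≠ -(m : ℂ))
    (haD : ∀ m : ℕ, 1 + 2 * A - D ≠ -(m : ℂ)) (haN : ∀ m : ℕ, 1 + 2 * A - -(N : ℂ) ≠ -(m : ℂ))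
    (haCD : ∀ m : ℕ, 1 + 2 * A - C - D - -(N : ℂ) ≠ -(m : ℂ)) :
    gammaRatio A C D (-(N : ℂ)) = rise (1 + 2 * A) N * rise (1 + 2 * A - C - D) N /
      (rise (1 + 2 * A - C) N * rise (1 + 2 * A - D) N) := by
  have shift : ∀ {x : ℂ}, (∀ m : ℕ, x ≠ -(m : ℂ)) → ∀ m : ℕ, x + N ≠ -(m : ℂ) :=
    fun hx m hm => hx (m + N) (by push_cast; linear_combination hm)
  simp only [sub_neg_eq_add] at haN haCD
  rw [← Gamma_add_natCast_div_Gamma haN, ← Gamma_add_natCast_div_Gamma haCD,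
    ← Gamma_add_natCast_div_Gamma (shift haC), ← Gamma_add_natCast_div_Gamma (shift haD)]
  simp only [gammaRatio, sub_neg_eq_add, div_eq_mul_inv, mul_inv, inv_inv]
  ring

/-! ### Series terms as rising factorials. -/

lemma term_upper4 (A B C D E : ℂ) (k : ℕ) :
    term (upper4 A B C D E) (lower3 A B C D E) 1 k =
      rise (A - B + 1 / 2) k * rise C k * rise D k * rise E k /
        (rise (A + 1 / 2) k * rise (2 * A - 2 * B + 1) k * rise (C + D + E - 2 * A) k *
          k.factorial) := by
  simp [term, poch, upper4, lower3, rise, mul_assoc]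

lemma poch_delta (x : ℂ) (k : ℕ) : poch (delta x 2) k = rise x (2 * k) / 4 ^ k := by
  rw [rise_two_mul, mul_div_cancel_left₀ _ (pow_ne_zero k (by norm_num))]
  simp [poch, delta, rise, List.range_succ]

lemma poch_append (a b : List ℂ) (k : ℕ) : poch (a ++ b) k = poch a k * poch b k := by
  simp [poch]

lemma term_upper9 {A : ℂ} (hA : ∀ k : ℕ, A / 2 ≠ -(k : ℂ)) (B C D E : ℂ) (k : ℕ) :
    term (upper9 A B C D E) (lower8 A B C D E) 1 k =
      wellPoisedCoeff A B k * (rise C (2 * k) * rise D (2 * k) * rise E (2 * k) /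
        (rise (1 + 2 * A - C) (2 * k) * rise (1 + 2 * A - D) (2 * k) *
          rise (1 + 2 * A - E) (2 * k))) := by
  have hA0 : A ≠ 0 := by simpa using hA 0
  have h := (rise_succ_left (A / 2) k).symm.trans (rise_succ _ _)
  have h1 : rise (1 + A / 2) k = rise (A / 2) k * (A + 2 * k) / A := by
    rw [eq_div_iff hA0, add_comm]
    linear_combination 2 * h
  have u : poch [A, 1 + A / 2, B] k = rise A k * rise (1 + A / 2) k * rise B k := by
    simp [poch, rise, mul_assoc]
  have l : poch [A / 2, 1 + A - B] k = rise (A / 2) k * rise (1 + A - B) k := by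
    simp [poch, rise]
  have h4 : (4 : ℂ) ^ k ≠ 0 := pow_ne_zero k (by norm_num)
  have h2 := rise_ne_zero hA k
  simp only [term, upper9, lower8, poch_append, poch_delta, u, l, h1, wellPoisedCoeff, one_pow,
    mul_one]
  generalize (4 : ℂ) ^ k = q at h4 ⊢
  generalize rise (A / 2) k = r at h2 ⊢
  generalize rise (1 + 2 * A - C) (2 * k) = c
  generalize rise (1 + 2 * A - D) (2 * k) = d
  generalize rise (1 + 2 * A - E) (2 * k) = e
  generalize rise (1 + A - B) k = b
  generalize (k.factorial : ℂ) = f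
  -- Only `r` and `q` are known to be nonzero; the other denominators stay as formal inverses. The
  -- three powers of 4 above and below cancel.
  have key : r * r⁻¹ * (q⁻¹ * q) ^ 3 = 1 := by
    rw [mul_inv_cancel₀ h2, inv_mul_cancel₀ h4, one_mul, one_pow]
  simp only [div_eq_mul_inv, mul_inv, inv_inv]
  linear_combination rise A k * ((A + 2 * k) * A⁻¹) * rise B k * rise C (2 * k) * rise D (2 * k) *
    rise E (2 * k) * b⁻¹ * c⁻¹ * d⁻¹ * e⁻¹ * f⁻¹ * key

/-- According to the parity of `m`, one of `-m/2` and `(1-m)/2` is a non-positive integer. -/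
lemma ne_neg_natCast_of_delta {x : ℂ} {b : List ℂ} (hb : Admissible b)
    (h : ∀ y ∈ delta x 2, y ∈ b) (m : ℕ) : x ≠ -(m : ℂ) := by
  rintro rfl
  have h0 := hb _ (h (-(m : ℂ) / 2) (by simp [delta, List.range_succ]))
  have h1 := hb _ (h (-(m : ℂ) / 2 + 1 / 2) (by simp [delta, List.range_succ]))
  obtain ⟨k, rfl | rfl⟩ := Nat.even_or_odd' m
  · exact h0 k (by push_cast; ring)
  · exact h1 k (by push_cast; ring)

lemma hasSum_of_neg_natCast {A B C D : ℂ} {N : ℕ}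
    (hlower8 : Admissible (lower8 A B C D (-(N : ℂ))))
    (hlower3 : Admissible (lower3 A B C D (-(N : ℂ))))
    (hgamma : ∀ m : ℕ, 1 + 2 * A - C - D - -(N : ℂ) ≠ -(m : ℂ)) :
    ∃ S : ℂ,
      HasSum (term (upper4 A B C D (-(N : ℂ))) (lower3 A B C D (-(N : ℂ))) 1) S ∧
      HasSum (term (upper9 A B C D (-(N : ℂ))) (lower8 A B C D (-(N : ℂ))) 1)
        (gammaRatio A C D (-(N : ℂ)) * S) := by
  have hA : ∀ m : ℕ, A / 2 ≠ -(m : ℂ) := hlower8 _ (by simp [lower8])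
  have hAB : ∀ m : ℕ, 1 + A - B ≠ -(m : ℂ) := hlower8 _ (by simp [lower8])
  have haC := ne_neg_natCast_of_delta (x := 1 + 2 * A - C) hlower8
    fun y hy => by simp only [lower8, List.mem_append]; tauto
  have haD := ne_neg_natCast_of_delta (x := 1 + 2 * A - D) hlower8
    fun y hy => by simp only [lower8, List.mem_append]; tauto
  have haN := ne_neg_natCast_of_delta (x := 1 + 2 * A - -(N : ℂ)) hlower8
    fun y hy => by simp only [lower8, List.mem_append]; tauto
  have hAh : ∀ m : ℕ, A + 1 / 2 ≠ -(m : ℂ) := hlower3 _ (by simp [lower3])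
  have hABt : ∀ m : ℕ, 2 * A - 2 * B + 1 ≠ -(m : ℂ) := hlower3 _ (by simp [lower3])
  have haCD : ∀ m : ℕ, C + D + -(N : ℂ) - 2 * A ≠ -(m : ℂ) := hlower3 _ (by simp [lower3])
  refine ⟨_, hasSum_sum_of_ne_finset_zero (s := Finset.range (N + 1)) fun k hk => ?_, ?_⟩
  · rw [term_upper4, rise_neg_eq_zero (show N < k by rw [Finset.mem_range] at hk; omega)]
    simp
  · simp only [term_upper4]
    rw [gammaRatio_neg_natCast haC haD haN hgamma,
      ← finite_identity hA hAB hAh hABt haC haD haN haCD]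
    simp only [← term_upper9 hA]
    refine hasSum_sum_of_ne_finset_zero fun k hk => ?_
    rw [term_upper9 hA,
      rise_neg_eq_zero (show N < 2 * k by rw [Finset.mem_range] at hk; omega)]
    simp

/-! ### Symmetry in `C`, `D`, `E`. -/

lemma term_congr_perm {a a' b b' : List ℂ} (ha : a.Perm a') (hb : b.Perm b') :
    term a b = term a' b' := by
  funext x k
  simp only [term, poch, (ha.map _).prod_eq, (hb.map _).prod_eq]

lemma Admissible.perm {b b' : List ℂ} (h : Admissible b) (hb : b.Perm b') : Admissible b' :=
  fun x hx => h x (hb.mem_iff.2 hx)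

lemma upper9_swap_right (A B C D E : ℂ) : (upper9 A B C D E).Perm (upper9 A B C E D) := by
  simp only [upper9, List.append_assoc]
  exact ((List.perm_append_comm.append_left _).append_left _)

lemma upper9_swap_left (A B C D E : ℂ) : (upper9 A B C D E).Perm (upper9 A B D C E) := by
  simp only [upper9]
  refine List.Perm.append_right _ ?_
  simp only [List.append_assoc]
  exact List.perm_append_comm.append_left _

lemma lower8_swap_right (A B C D E : ℂ) : (lower8 A B C D E).Perm (lower8 A B C E D) := by
  simp only [lower8, List.append_assoc]
  exact ((List.perm_append_comm.append_left _).append_left _)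

lemma lower8_swap_left (A B C D E : ℂ) : (lower8 A B C D E).Perm (lower8 A B D C E) := by
  simp only [lower8]
  refine List.Perm.append_right _ ?_
  simp only [List.append_assoc]
  exact List.perm_append_comm.append_left _

lemma upper4_swap_right (A B C D E : ℂ) : (upper4 A B C D E).Perm (upper4 A B C E D) :=
  ((List.Perm.swap _ _ _).cons _).cons _

lemma upper4_swap_left (A B C D E : ℂ) : (upper4 A B C D E).Perm (upper4 A B D C E) :=
  (List.Perm.swap _ _ _).cons _

lemma lower3_swap_right (A B C D E : ℂ) : lower3 A B C D E = lower3 A B C E D := by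
  simp only [lower3, add_right_comm]

lemma lower3_swap_left (A B C D E : ℂ) : lower3 A B C D E = lower3 A B D C E := by
  simp only [lower3, add_comm C D]

lemma gammaRatio_swap_right (A C D E : ℂ) : gammaRatio A C D E = gammaRatio A C E D := by
  simp only [gammaRatio, sub_right_comm _ E D]
  ring

lemma gammaRatio_swap_left (A C D E : ℂ) : gammaRatio A C D E = gammaRatio A D C E := by
  simp only [gammaRatio, sub_right_comm _ D C]
  ring

end HypSeries

theorem mainTheorem7 (A B C D E : ℂ)
    (hlower8 : HypSeries.Admissible (HypSeries.lower8 A B C D E))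
    (hlower3 : HypSeries.Admissible (HypSeries.lower3 A B C D E))
    (hgamma : ∀ m : ℕ, 1 + 2 * A - C - D - E ≠ -(m : ℂ))
    (hterm : HypSeries.Terminates (HypSeries.upper4 A B C D E)) :
    ∃ S : ℂ,
      HasSum (HypSeries.term (HypSeries.upper4 A B C D E) (HypSeries.lower3 A B C D E) 1) S ∧
      HasSum (HypSeries.term (HypSeries.upper9 A B C D E) (HypSeries.lower8 A B C D E) 1)
        (HypSeries.gammaRatio A C D E * S) := by
  open HypSeries in
  have hright : ∀ {C D : ℂ} {N : ℕ}, Admissible (lower8 A B C (-(N : ℂ)) D) →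
      Admissible (lower3 A B C (-(N : ℂ)) D) →
      (∀ m : ℕ, 1 + 2 * A - C - -(N : ℂ) - D ≠ -(m : ℂ)) → ∃ S : ℂ,
      HasSum (term (upper4 A B C (-(N : ℂ)) D) (lower3 A B C (-(N : ℂ)) D) 1) S ∧
      HasSum (term (upper9 A B C (-(N : ℂ)) D) (lower8 A B C (-(N : ℂ)) D) 1)
        (gammaRatio A C (-(N : ℂ)) D * S) := by
    intro C D N h8 h3 hg
    rw [term_congr_perm (upper4_swap_right A B C _ D) (.refl _), lower3_swap_right,
      term_congr_perm (upper9_swap_right A B C _ D) (lower8_swap_right A B C _ D),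
      gammaRatio_swap_right]
    rw [lower3_swap_right] at h3
    exact hasSum_of_neg_natCast (h8.perm (lower8_swap_right A B C _ D)) h3
      fun m => by rw [sub_right_comm]; exact hg m
  obtain ⟨x, hx, N, rfl⟩ := hterm
  simp only [HypSeries.upper4, List.mem_cons, List.not_mem_nil, or_false] at hx
  rcases hx with h | rfl | rfl | rfl
  -- `A - B + 1/2 = -N` would make the lower parameter `2A - 2B + 1` equal to `-2N`.
  · refine absurd ?_ (hlower3 (2 * A - 2 * B + 1) (by simp [HypSeries.lower3]) (2 * N))
    push_cast
    linear_combination -2 * h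
  · open HypSeries in
    rw [term_congr_perm (upper4_swap_left A B _ D E) (.refl _), lower3_swap_left,
      term_congr_perm (upper9_swap_left A B _ D E) (lower8_swap_left A B _ D E),
      gammaRatio_swap_left]
    rw [lower3_swap_left] at hlower3
    exact hright (hlower8.perm (lower8_swap_left A B _ D E)) hlower3
      fun m => by rw [sub_right_comm (1 + 2 * A)]; exact hgamma m
  · exact hright hlower8 hlower3 hgamma
  · exact HypSeries.hasSum_of_neg_natCast hlower8 hlower3 hgamma
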